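/- Let $R\subseteq T$ be an extension of commutative unital rings whose inclusion $f\colon R\to T$ is a flat epimorphism of the category of commutative rings. Let $\mathrm{Supp}(f)$ be the set of all prime ideals $P$ of $R$ such that the induced map $R_P\to T_P=T\otimes_R R_P$ is not an isomorphism, let $\mathcal O(R,T)=\{a\in R\mid (T/R)_a=0\}$ be the Oda ideal of the $R$-module $T/R$, and let $\mathrm{Spec}(T,R)$ be the image of the map $\mathrm{Spec}(T)\to\mathrm{Spec}(R)$, $Q\mapsto f^{-1}(Q)$. For an ideal $I$ of $R$ put $\mathrm D(I)=\{P\in\mathrm{Spec}(R)\mid I\not\subseteq P\}$. Suppose that $\mathrm{Supp}(f)$ is Zariski closed in $\mathrm{Spec}(R)$; this is the case, for example, if $T$ is an $R$-algebra of finite type. Then: 1. $\mathrm{Spec}(T,R)=\mathrm D(\mathcal O(R,T))$, and this is an affine open subset of the scheme $\mathrm{Spec}(R)$; 2. $\mathcal O(R,T)$ is the radical of a finitely generated ideal of $R$; 3. $\mathcal O(R,T)T=T$; 4. $T$ is isomorphic, as an $R$-algebra, to the ring $\Gamma(\mathrm D(\mathcal O(R,T)),\mathcal O_{\mathrm{Spec}(R)})$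 of sections of the structure sheaf of $\mathrm{Spec}(R)$ over $\mathrm D(\mathcal O(R,T))$. -/

import Mathlib

open AlgebraicGeometry

namespace OdaIdeal

universe u v

section Module

variable (R : Type u) [CommRing R] (E : Type v) [AddCommGroup E] [Module R E]

/-- `E_a = 0` if and only if every element of `E` is killed by a power of `a`. -/
theorem subsingleton_away_iff (a : R) :
    Subsingleton (LocalizedModule (Submonoid.powers a) E) ↔ ∀ x : E, ∃ n : ℕ, a ^ n • x = 0 := by
  rw [LocalizedModule.subsingleton_iff]
  refine forall_congr' fun x => ⟨?_, ?_⟩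
  · rintro ⟨_, ⟨n, rfl⟩, h⟩
    exact ⟨n, h⟩
  · rintro ⟨n, h⟩
    exact ⟨a ^ n, ⟨n, rfl⟩, h⟩

/-- The Oda ideal `𝒪_R(E)` of an `R`-module `E`: the set of all `a ∈ R` such that `E_a = 0`. -/
def oda : Ideal R where
  carrier := {a | Subsingleton (LocalizedModule (Submonoid.powers a) E)}
  zero_mem' := (subsingleton_away_iff R E 0).2 fun x => ⟨1, by simp⟩
  add_mem' := by
    intro a b ha hb
    rw [Set.mem_ofPred_eq, subsingleton_away_iff] at ha hb ⊢
    intro x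
    obtain ⟨m, hm⟩ := ha x
    obtain ⟨n, hn⟩ := hb x
    let I : Ideal R := LinearMap.ker (LinearMap.toSpanSingleton R E x)
    have ha' : a ∈ I.radical :=
      ⟨m, by simpa [I] using hm⟩
    have hb' : b ∈ I.radical :=
      ⟨n, by simpa [I] using hn⟩
    obtain ⟨k, hk⟩ := Ideal.add_mem _ ha' hb'
    exact ⟨k, by simpa [I] using hk⟩
  smul_mem' := by
    intro c a ha
    rw [Set.mem_ofPred_eq, subsingleton_away_iff] at ha ⊢
    intro x
    obtain ⟨n, hn⟩ := ha x
    exact ⟨n, by rw [smul_eq_mul, mul_pow, mul_smul, hn, smul_zero]⟩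

end Module

section Extension

variable (R : Type u) [CommRing R] (T : Type v) [CommRing T] [Algebra R T]

/-- The Oda ideal `𝒪(R, T) = 𝒪_R(T / R)` of a ring extension `R ⊆ T`, where `T / R` is the
quotient of the `R`-module `T` by the image of `R`. -/
def odaExt : Ideal R :=
  oda R (T ⧸ LinearMap.range (Algebra.linearMap R T))

end Extension

/-- The support `Supp(f)` of a ring morphism `f : R → S`: the set of all prime ideals `P` of `R`
such that `f_P : R_P → S_P` is not an isomorphism. Here `S_P` is the localization of the ring `S`
at the image under `f` of `R \ P`, and `f_P` is the morphism induced by `f`. -/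
def suppHom {R : Type u} [CommRing R] {S : Type v} [CommRing S] (f : R →+* S) :
    Set (PrimeSpectrum R) :=
  {P | ¬ Function.Bijective
    (IsLocalization.map (M := P.asIdeal.primeCompl) (S := Localization.AtPrime P.asIdeal)
      (Localization (P.asIdeal.primeCompl.map f)) f (Submonoid.le_comap_map _))}

/-- The Zariski open subset `D(I)` of `Spec R`: the complement of `V(I)`. -/
def openD {R : Type u} [CommRing R] (I : Ideal R) : TopologicalSpace.Opens (PrimeSpectrum R) :=
  ⟨(PrimeSpectrum.zeroLocus (I : Set R))ᶜ, (PrimeSpectrum.isClosed_zeroLocus _).isOpen_compl⟩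

/-- `Spec(T, R)`: the image of the spectral map `Spec T → Spec R` of the `R`-algebra `T`. -/
def specImage (R : Type u) [CommRing R] (T : Type v) [CommRing T] [Algebra R T] :
    Set (PrimeSpectrum R) :=
  Set.range (PrimeSpectrum.comap (algebraMap R T))

/-- The ring of sections of the structure sheaf of `Spec R` over an open subset `U`; it is an
`R`-algebra through the restriction map from the global sections. -/
abbrev Sections (R : Type u) [CommRing R] (U : TopologicalSpace.Opens (PrimeSpectrum R)) : Type u :=
  (Spec.structureSheaf R).obj.obj (Opposite.op U)

noncomputable instance sectionsAlgebra (R : Type u) [CommRing R]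
    (U : TopologicalSpace.Opens (PrimeSpectrum R)) : Algebra R (Sections R U) :=
  StructureSheaf.openAlgebra R (Opposite.op U)

end OdaIdeal

open CategoryTheory TensorProduct

namespace OdaIdeal

universe u v

/-! ### Conductors and flat epimorphisms. -/

section Conductor

variable (R : Type u) [CommRing R] {T : Type v} [CommRing T] [Algebra R T]

/-! Everything is read off from the conductors `(R : t)`. The map is an isomorphism at `P` iff no
conductor lies in `P`; and a flat epimorphism has `(R : t)T = T`, so primes in the image contain no
conductor. Hence `Spec(T, R)` is the complement of `Supp(f)`. The Oda ideal is the intersection of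
the radicals of the conductors, so `D(𝒪)` is the interior of that complement, and all of it once the
support is closed. Then no prime of `T` contains `𝒪T`, and quasi-compactness of the image yields a
finitely generated ideal with radical `𝒪`. Finally `Spec T → D(𝒪)` is a flat quasi-compact
surjective monomorphism, hence an isomorphism. -/

/-- The conductor ideal `(R :_R t)` of those `a ∈ R` such that `a • t` comes from `R`. -/
def conductorAt (t : T) : Ideal R :=
  LinearMap.ker (LinearMap.toSpanSingleton R (T ⧸ LinearMap.range (Algebra.linearMap R T))
    (Submodule.Quotient.mk t))

variable {R}

theorem mem_conductorAt {t : T} {a : R} :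
    a ∈ conductorAt R t ↔ ∃ r, algebraMap R T r = algebraMap R T a * t := by
  rw [conductorAt, LinearMap.mem_ker, LinearMap.toSpanSingleton_apply,
    ← Submodule.Quotient.mk_smul, Submodule.Quotient.mk_eq_zero]
  simp [Algebra.smul_def]

theorem mem_odaExt {a : R} :
    a ∈ odaExt R T ↔ ∀ t : T, a ∈ (conductorAt R t).radical := by
  change Subsingleton _ ↔ _
  rw [subsingleton_away_iff, (Submodule.Quotient.mk_surjective _).forall]
  rfl

-- For an epimorphism `x ⊗ y = xy ⊗ 1` in `T ⊗ T`, and `1` dies in `T / R`.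
variable (R T) in
theorem subsingleton_tensor_quotient_range [Algebra.IsEpi R T] :
    Subsingleton (T ⊗[R] (T ⧸ LinearMap.range (Algebra.linearMap R T))) := by
  refine subsingleton_of_forall_eq 0 fun z => ?_
  induction z with
  | zero => rfl
  | add a b ha hb => rw [ha, hb, add_zero]
  | tmul x y =>
    obtain ⟨y, rfl⟩ := Submodule.Quotient.mk_surjective _ y
    have h : x ⊗ₜ[R] y = (x * y) ⊗ₜ[R] (1 : T) := by
      apply (Algebra.IsEpi.injective_lift_mul (R := R) (A := T))
      simp
    have h' := congrArg (LinearMap.lTensor T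
      (LinearMap.range (Algebra.linearMap R T)).mkQ) h
    rw [LinearMap.lTensor_tmul, LinearMap.lTensor_tmul] at h'
    refine h'.trans ?_
    rw [Submodule.mkQ_apply, (Submodule.Quotient.mk_eq_zero _).2 (LinearMap.mem_range.2 ⟨1, by simp⟩), tmul_zero]

/-- The conductors of a flat epimorphism extend to the unit ideal. -/
theorem map_conductorAt_eq_top [Module.Flat R T] [Algebra.IsEpi R T] (t : T) :
    (conductorAt R t).map (algebraMap R T) = ⊤ := by
  have := subsingleton_tensor_quotient_range R T
  -- Flatness keeps `(R : t) → R → T / R` exact after tensoring with `T`; the last term vanishes, so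
  -- `1 ⊗ 1` comes from `T ⊗ (R : t)`.
  have hex := Module.Flat.lTensor_exact T (LinearMap.exact_subtype_ker_map
    (LinearMap.toSpanSingleton R (T ⧸ LinearMap.range (Algebra.linearMap R T))
      (Submodule.Quotient.mk t)))
  obtain ⟨z, hz⟩ := (hex ((1 : T) ⊗ₜ[R] (1 : R))).1 (Subsingleton.elim _ _)
  have key : ∀ z : T ⊗[R] (conductorAt R t),
      TensorProduct.rid R T (LinearMap.lTensor T (conductorAt R t).subtype z) ∈
        (conductorAt R t).map (algebraMap R T) := by
    intro z
    induction z with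
    | zero => simp
    | add a b ha hb => rw [map_add, map_add]; exact add_mem ha hb
    | tmul x y =>
      simp only [LinearMap.lTensor_tmul, Submodule.subtype_apply, TensorProduct.rid_tmul,
        Algebra.smul_def]
      exact Ideal.mul_mem_right _ _ (Ideal.mem_map_of_mem _ y.2)
  rw [Ideal.eq_top_iff_one]
  have h := key z
  have h1 : TensorProduct.rid R T (LinearMap.lTensor T (conductorAt R t).subtype z) = 1 := by
    refine (congrArg (TensorProduct.rid R T) hz).trans ?_
    rw [TensorProduct.rid_tmul, one_smul]
  rwa [h1] at h

theorem exists_mem_conductorAt_notMem [Module.Flat R T] [Algebra.IsEpi R T]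
    {P : PrimeSpectrum R} (hP : P ∈ specImage R T) (t : T) :
    ∃ a ∈ conductorAt R t, a ∉ P.asIdeal := by
  obtain ⟨Q, rfl⟩ := hP
  by_contra! h
  refine Q.isPrime.ne_top (top_le_iff.1 ?_)
  rw [← map_conductorAt_eq_top (R := R) t, Ideal.map_le_iff_le_comap]
  exact h

end Conductor

/-! ### Support, spectral image and Oda ideal. -/

section Support

variable {R : Type u} [CommRing R] {T : Type v} [CommRing T] [Algebra R T]

/-- Localization preserves injectivity, so only surjectivity matters: each `t` needs a denominator
outside `P`. -/
theorem notMem_suppHom_iff (hinj : Function.Injective (algebraMap R T)) {P : PrimeSpectrum R} :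
    P ∉ suppHom (algebraMap R T) ↔ ∀ t : T, ∃ a ∈ conductorAt R t, a ∉ P.asIdeal := by
  change ¬ ¬ Function.Bijective _ ↔ _
  rw [not_not]
  constructor
  · rintro ⟨-, hsurj⟩ t
    obtain ⟨x, hx⟩ := hsurj (algebraMap T _ t)
    obtain ⟨r, s, rfl⟩ := IsLocalization.exists_mk'_eq P.asIdeal.primeCompl x
    rw [IsLocalization.map_mk', IsLocalization.mk'_eq_iff_eq_mul, ← map_mul,
      IsLocalization.eq_iff_exists (P.asIdeal.primeCompl.map (algebraMap R T))] at hx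
    obtain ⟨⟨_, c, hc, rfl⟩, h⟩ := hx
    simp only at h
    refine ⟨c * s, mem_conductorAt.2 ⟨c * r, ?_⟩, mul_mem hc s.2⟩
    rw [map_mul, map_mul, h]
    ring
  · intro h
    refine ⟨IsLocalization.map_injective_of_injective _ _ _ hinj, fun y => ?_⟩
    obtain ⟨t, ⟨_, c, hc, rfl⟩, rfl⟩ :=
      IsLocalization.exists_mk'_eq (P.asIdeal.primeCompl.map (algebraMap R T)) y
    obtain ⟨a, ha, haP⟩ := h t
    obtain ⟨r, hr⟩ := mem_conductorAt.1 ha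
    refine ⟨IsLocalization.mk' _ r (⟨a, haP⟩ * ⟨c, hc⟩ : P.asIdeal.primeCompl), ?_⟩
    rw [IsLocalization.map_mk', IsLocalization.mk'_eq_iff_eq]
    congr 1
    simp only [Submonoid.coe_mul, map_mul, hr]
    ring

/-- Contract the maximal ideal of `R_P` along `T → T_P ≅ R_P`. -/
theorem mem_specImage_of_notMem_suppHom {P : PrimeSpectrum R}
    (hP : P ∉ suppHom (algebraMap R T)) : P ∈ specImage R T := by
  have hb := not_not.1 hP
  set g := IsLocalization.map (M := P.asIdeal.primeCompl)
    (S := Localization.AtPrime P.asIdeal)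
    (Localization (P.asIdeal.primeCompl.map (algebraMap R T))) (algebraMap R T)
    (Submonoid.le_comap_map _)
  let e := RingEquiv.ofBijective g hb
  let m : PrimeSpectrum (Localization.AtPrime P.asIdeal) :=
    ⟨IsLocalRing.maximalIdeal _, inferInstance⟩
  refine ⟨PrimeSpectrum.comap (e.symm.toRingHom.comp (algebraMap T _)) m, ?_⟩
  rw [← PrimeSpectrum.comap_comp_apply]
  have : (e.symm.toRingHom.comp (algebraMap T _)).comp (algebraMap R T) =
      algebraMap R (Localization.AtPrime P.asIdeal) := by
    ext r
    exact (RingEquiv.symm_apply_eq e).2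
      (IsLocalization.map_eq (M := P.asIdeal.primeCompl) (Submonoid.le_comap_map _) r).symm
  rw [this]
  ext1
  exact IsLocalization.AtPrime.under_maximalIdeal _ _

theorem specImage_eq_compl_suppHom [Module.Flat R T] [Algebra.IsEpi R T]
    (hinj : Function.Injective (algebraMap R T)) :
    specImage R T = (suppHom (algebraMap R T))ᶜ :=
  Set.Subset.antisymm
    (fun _ hP => (notMem_suppHom_iff hinj).2 (exists_mem_conductorAt_notMem hP))
    fun _ => mem_specImage_of_notMem_suppHom

theorem mem_odaExt_iff_basicOpen_subset (hinj : Function.Injective (algebraMap R T)) {a : R} :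
    a ∈ odaExt R T ↔
      (PrimeSpectrum.basicOpen a : Set (PrimeSpectrum R)) ⊆ (suppHom (algebraMap R T))ᶜ := by
  simp only [mem_odaExt, Ideal.radical_eq_sInf, Submodule.mem_sInf, Set.mem_ofPred_eq]
  constructor
  · intro h P hP
    refine (notMem_suppHom_iff hinj).2 fun t => ?_
    by_contra! hle
    exact hP (h t P.asIdeal ⟨hle, P.isPrime⟩)
  · rintro h t I ⟨hle, hI⟩
    by_contra ha
    obtain ⟨b, hb, hbI⟩ := (notMem_suppHom_iff hinj (P := ⟨I, hI⟩)).1 (h ha) t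
    exact hbI (hle hb)

theorem openD_odaExt_of_isClosed (hinj : Function.Injective (algebraMap R T))
    (hcl : IsClosed (suppHom (algebraMap R T))) :
    (openD (odaExt R T) : Set (PrimeSpectrum R)) = (suppHom (algebraMap R T))ᶜ := by
  ext P
  change ¬ _ ↔ _
  rw [PrimeSpectrum.mem_zeroLocus, Set.not_subset]
  constructor
  · rintro ⟨a, ha, haP⟩
    exact (mem_odaExt_iff_basicOpen_subset hinj).1 ha haP
  · intro hP
    obtain ⟨_, ⟨a, rfl⟩, haP, hle⟩ :=
      PrimeSpectrum.isTopologicalBasis_basic_opens.exists_subset_of_mem_open hP hcl.isOpen_compl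
    exact ⟨a, (mem_odaExt_iff_basicOpen_subset hinj).2 hle, haP⟩

theorem isClosed_suppHom_of_finiteType [Algebra.FiniteType R T]
    (hinj : Function.Injective (algebraMap R T)) : IsClosed (suppHom (algebraMap R T)) := by
  obtain ⟨s, hs⟩ := ‹Algebra.FiniteType R T›.out
  rw [← isOpen_compl_iff, isOpen_iff_forall_mem_open]
  intro P hP
  have hP' := (notMem_suppHom_iff hinj).1 hP
  choose a ha haP using hP'
  -- The `t` multiplied into `R` by some power of this product form a subalgebra containing the
  -- generators.
  refine ⟨PrimeSpectrum.basicOpen (∏ t ∈ s, a t), ?_, PrimeSpectrum.isOpen_basicOpen, ?_⟩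
  · rw [← mem_odaExt_iff_basicOpen_subset hinj, mem_odaExt]
    intro t
    have ht : t ∈ Algebra.adjoin R (s : Set T) := hs ▸ Algebra.mem_top
    induction ht using Algebra.adjoin_induction with
    | mem x hx =>
      exact Ideal.le_radical (Ideal.mem_of_dvd _ (Finset.dvd_prod_of_mem a hx) (ha x))
    | algebraMap r =>
      exact ⟨1, mem_conductorAt.2 ⟨(∏ t ∈ s, a t) ^ 1 * r, by simp⟩⟩
    | add x y _ _ hx hy =>
      obtain ⟨m, hm⟩ := hx
      obtain ⟨n, hn⟩ := hy
      obtain ⟨r, hr⟩ := mem_conductorAt.1 hm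
      obtain ⟨q, hq⟩ := mem_conductorAt.1 hn
      refine ⟨m + n, mem_conductorAt.2 ⟨(∏ t ∈ s, a t) ^ n * r + (∏ t ∈ s, a t) ^ m * q, ?_⟩⟩
      rw [map_add, map_mul, map_mul, hr, hq, pow_add, map_mul]
      ring
    | mul x y _ _ hx hy =>
      obtain ⟨m, hm⟩ := hx
      obtain ⟨n, hn⟩ := hy
      obtain ⟨r, hr⟩ := mem_conductorAt.1 hm
      obtain ⟨q, hq⟩ := mem_conductorAt.1 hn
      refine ⟨m + n, mem_conductorAt.2 ⟨r * q, ?_⟩⟩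
      rw [map_mul, hr, hq, pow_add, map_mul]
      ring
  · exact fun h => by
      obtain ⟨t, -, ht⟩ := P.isPrime.prod_mem_iff.1 h
      exact haP t ht

theorem odaExt_eq_radical_of_openD {J : Ideal R} (hinj : Function.Injective (algebraMap R T))
    (hJ : (PrimeSpectrum.zeroLocus (J : Set R))ᶜ = (suppHom (algebraMap R T))ᶜ) :
    odaExt R T = J.radical := by
  ext a
  rw [mem_odaExt_iff_basicOpen_subset hinj, ← hJ, PrimeSpectrum.basicOpen_eq_zeroLocus_compl,
    Set.compl_subset_compl, PrimeSpectrum.subset_zeroLocus_iff_subset_vanishingIdeal,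
    PrimeSpectrum.vanishingIdeal_zeroLocus_eq_radical, Set.singleton_subset_iff, SetLike.mem_coe]

theorem map_eq_top_of_specImage_subset {I : Ideal R}
    (h : specImage R T ⊆ openD I) : I.map (algebraMap R T) = ⊤ := by
  by_contra hne
  obtain ⟨M, hM, hle⟩ := Ideal.exists_le_maximal _ hne
  exact h ⟨⟨M, hM.isPrime⟩, rfl⟩ (Ideal.map_le_iff_le_comap.1 hle)

/-- If `𝒪(R, T) T = T`, then `T` is essentially of the size of `R`. -/
theorem small_of_map_odaExt_eq_top (h : (odaExt R T).map (algebraMap R T) = ⊤) :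
    Small.{u} T := by
  have hex : ∀ (t : T) (a : odaExt R T), ∃ p : ℕ × R,
      algebraMap R T p.2 = algebraMap R T (a.1 ^ p.1) * t := by
    intro t a
    obtain ⟨n, hn⟩ := mem_odaExt.1 a.2 t
    obtain ⟨r, hr⟩ := mem_conductorAt.1 hn
    exact ⟨(n, r), hr⟩
  choose F hF using hex
  -- If `F t = F t'`, the shared exponents show that each `a ∈ 𝒪` has a power killing `t - t'`; as
  -- `𝒪T = T`, this forces `t = t'`.
  refine small_of_injective (f := F) fun t t' htt' => ?_
  let A : Ideal T := LinearMap.ker (LinearMap.toSpanSingleton T T (t - t'))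
  have hA : A.radical = ⊤ := by
    rw [← top_le_iff, ← h, Ideal.map_le_iff_le_comap]
    intro a ha
    refine ⟨(F t ⟨a, ha⟩).1, ?_⟩
    have h1 := hF t ⟨a, ha⟩
    have h2 := hF t' ⟨a, ha⟩
    rw [← htt', h1] at h2
    simp only [A, LinearMap.mem_ker, LinearMap.toSpanSingleton_apply, smul_eq_mul]
    rw [← map_pow, mul_sub, h2, sub_self]
  rw [Ideal.radical_eq_top, Ideal.eq_top_iff_one] at hA
  simpa [A, sub_eq_zero] using hA

end Support

/-! ### Invariance under change of algebra. -/

section Transfer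

variable {R : Type u} [CommRing R] {T : Type v} [CommRing T] [Algebra R T]
  {T' : Type*} [CommRing T'] [Algebra R T']

theorem _root_.Algebra.IsEpi.of_algEquiv (h : Algebra.IsEpi R T) (e : T ≃ₐ[R] T') :
    Algebra.IsEpi R T' := by
  rw [Algebra.isEpi_iff_forall_one_tmul_eq] at h ⊢
  intro a
  simpa using congrArg (TensorProduct.map e.toLinearMap e.toLinearMap) (h (e.symm a))

theorem specImage_subset_of_algHom (f : T →ₐ[R] T') : specImage R T' ⊆ specImage R T := by
  rintro _ ⟨Q, rfl⟩
  exact ⟨PrimeSpectrum.comap f.toRingHom Q, by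
    rw [← PrimeSpectrum.comap_comp_apply, AlgHom.toRingHom_eq_coe, f.comp_algebraMap]⟩

end Transfer

/-! ### Open immersions and sections. -/

section Scheme

variable {R T : Type u} [CommRing R] [CommRing T] [Algebra R T]

/-- A flat epimorphism with open spectral image induces an open immersion. -/
theorem isOpenImmersion_of_isOpen_specImage [Module.Flat R T] [Algebra.IsEpi R T]
    (hU : IsOpen (specImage R T)) :
    IsOpenImmersion (Spec.map (CommRingCat.ofHom (algebraMap R T))) := by
  have hepi : Epi (CommRingCat.ofHom (algebraMap R T)) := CommRingCat.epi_iff_epi.2 inferInstance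
  set f := Spec.map (CommRingCat.ofHom (algebraMap R T)) with hf
  have hmono : Mono f := by
    exact inferInstanceAs (Mono (Scheme.Spec.map (CommRingCat.ofHom (algebraMap R T)).op))
  have hflat : Flat f := by
    rw [hf, Flat.SpecMap_iff]
    exact RingHom.flat_algebraMap_iff.2 inferInstance
  let U : (Spec (CommRingCat.of R)).Opens := ⟨Set.range f.base, hU⟩
  have hι : IsOpenImmersion U.ι := U.instIsOpenImmersionι
  let f' := IsOpenImmersion.lift U.ι f (by rw [Scheme.Opens.range_ι]; exact subset_rfl)
  have heq : f = f' ≫ U.ι := by simp [f']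
  have hflat' : Flat f' :=
    (instHasOfPostcompPropertySchemeIsOpenImmersionOfIsStableUnderBaseChange
      (@Flat : MorphismProperty Scheme.{u})).of_postcomp f' U.ι hι (by rwa [← heq])
  have hmono' : Mono f' := mono_of_mono_fac heq.symm
  have hsurj : Surjective f' := ⟨fun ⟨x, ⟨y, hy⟩⟩ ↦
      ⟨y, by apply U.ι.injective; simp [← Scheme.Hom.comp_apply, f', hy]⟩⟩
  have hqc : QuasiCompact f' := by
    have : QuasiCompact (f' ≫ U.ι) := by rw [← heq]; infer_instance
    exact .of_comp f' U.ι
  have := Flat.isIso_of_surjective_of_mono f'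
  rw [heq]
  infer_instance

/-- Sections over the image of an affine open immersion `Spec B → Spec A` are given by `B`. -/
theorem exists_iso_of_opensRange_eq {A B : CommRingCat.{u}} (φ : A ⟶ B)
    [IsOpenImmersion (Spec.map φ)] (U : (Spec A).Opens) (hU : (Spec.map φ).opensRange = U) :
    ∃ i : Γ(Spec A, U) ≅ B, ((Scheme.ΓSpecIso A).inv ≫
      (Spec A).presheaf.map (homOfLE le_top : U ⟶ ⊤).op) ≫ i.hom = φ := by
  have hpre : ⊤ ≤ (Spec.map φ) ⁻¹ᵁ U := by rw [← hU]; simp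
  have happ : (Spec.map φ).appLE ⊤ ⊤ le_top = (Spec.map φ).appTop := Scheme.Hom.appLE_eq_app _
  have hU' : IsIso ((Spec.map φ).app U) := (Spec.map φ).isIso_app U hU.ge
  have hiso : IsIso ((Spec.map φ).appLE U ⊤ hpre) := by
    have : IsIso (homOfLE hpre) :=
      ⟨homOfLE le_top, Subsingleton.elim _ _, Subsingleton.elim _ _⟩
    unfold Scheme.Hom.appLE
    infer_instance
  refine ⟨asIso ((Spec.map φ).appLE U ⊤ hpre) ≪≫ Scheme.ΓSpecIso B, ?_⟩
  rw [Iso.trans_hom, asIso_hom, Category.assoc, Scheme.Hom.map_appLE_assoc, happ,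
    Scheme.ΓSpecIso_naturality, Iso.inv_hom_id_assoc]

theorem isAffineOpen_and_nonempty_algEquiv_sections [Module.Flat R T] [Algebra.IsEpi R T]
    (U : TopologicalSpace.Opens (PrimeSpectrum R)) (hU : specImage R T = U) :
    IsAffineOpen (X := Spec (CommRingCat.of R)) U ∧ Nonempty (T ≃ₐ[R] Sections R U) := by
  have := isOpenImmersion_of_isOpen_specImage (R := R) (T := T) (hU ▸ U.isOpen)
  have hrange : (Spec.map (CommRingCat.ofHom (algebraMap R T))).opensRange = U :=
    TopologicalSpace.Opens.ext hU
  obtain ⟨i, hi⟩ := exists_iso_of_opensRange_eq _ _ hrange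
  rw [← Scheme.toOpen_eq (R := CommRingCat.of R) U] at hi
  let e : Sections R U ≃+* T := i.commRingCatIsoToRingEquiv
  exact ⟨hrange ▸ isAffineOpen_opensRange _,
    ⟨(AlgEquiv.ofRingEquiv (f := e) fun r => congrArg (fun g => g.hom r) hi).symm⟩⟩

end Scheme

end OdaIdeal

theorem mainTheorem5 {R : Type*} [CommRing R] {T : Type*} [CommRing T] [Algebra R T]
    (hinj : Function.Injective (algebraMap R T)) (hflat : Module.Flat R T)
    (hepi : Algebra.IsEpi R T) :
    (Algebra.FiniteType R T → IsClosed (OdaIdeal.suppHom (algebraMap R T))) ∧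
    (IsClosed (OdaIdeal.suppHom (algebraMap R T)) →
      OdaIdeal.specImage R T = OdaIdeal.openD (OdaIdeal.odaExt R T) ∧
      IsAffineOpen (X := Spec (CommRingCat.of R)) (OdaIdeal.openD (OdaIdeal.odaExt R T)) ∧
      (∃ J : Ideal R, J.FG ∧ OdaIdeal.odaExt R T = J.radical) ∧
      (OdaIdeal.odaExt R T).map (algebraMap R T) = ⊤ ∧
      Nonempty (T ≃ₐ[R] OdaIdeal.Sections R (OdaIdeal.openD (OdaIdeal.odaExt R T)))) := by
  refine ⟨fun _ => OdaIdeal.isClosed_suppHom_of_finiteType hinj, fun hcl => ?_⟩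
  have himage := OdaIdeal.specImage_eq_compl_suppHom (R := R) (T := T) hinj
  have hspec := himage.trans (OdaIdeal.openD_odaExt_of_isClosed hinj hcl).symm
  have htop := OdaIdeal.map_eq_top_of_specImage_subset hspec.le
  -- The scheme argument needs `R` and `T` in one universe, so `T` is replaced by `Shrink T`.
  have := OdaIdeal.small_of_map_odaExt_eq_top htop
  have := hepi.of_algEquiv (Shrink.algEquiv R T).symm
  obtain ⟨haff, ⟨e⟩⟩ := OdaIdeal.isAffineOpen_and_nonempty_algEquiv_sections
    (T := Shrink T) (OdaIdeal.openD (OdaIdeal.odaExt R T))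
    (((OdaIdeal.specImage_subset_of_algHom (Shrink.algEquiv R T).symm.toAlgHom).antisymm
      (OdaIdeal.specImage_subset_of_algHom (Shrink.algEquiv R T).toAlgHom)).trans hspec)
  refine ⟨hspec, haff, ?_, htop, ⟨(Shrink.algEquiv R T).symm.trans e⟩⟩
  obtain ⟨J, hJ, hJ'⟩ := PrimeSpectrum.isCompact_isOpen_iff_ideal.1
    ⟨isCompact_range (PrimeSpectrum.continuous_comap (algebraMap R T)),
      (himage ▸ hcl.isOpen_compl : IsOpen (OdaIdeal.specImage R T))⟩
  exact ⟨J, hJ, OdaIdeal.odaExt_eq_radical_of_openD hinj (hJ'.trans himage)⟩
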